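/- Let $N\ge 0$ and let $W\in\mathbb{C}[x_1,\dots,x_N]$ be an invertible polynomial, that is: $W$ is quasi-homogeneous of weight $1$ for some rational weights $\mathrm{wt}(x_j)=q_j\in\mathbb{Q}\cap(0,\tfrac12]$; $W$ has an isolated critical point at the origin; $W$ contains no monomial $x_ix_j$ with $i\ne j$; the number of monomials occurring in $W$ is $N$; and the $N\times N$ matrix of their exponents is invertible. (The weights $q_j$ are then uniquely determined by $W$.) Let $$G_W^{\max}=\{(\lambda_1,\dots,\lambda_N)\in(\mathbb{C}^*)^N : W(\lambda_1x_1,\dots,\lambda_Nx_N)=W(x_1,\dots,x_N)\}$$ and $\mathrm{Jac}(W)=\mathbb{C}[x_1,\dots,x_N]/(\partial_1W,\dots,\partial_NW)$. The group $G_W^{\max}$ acts on $\mathrm{Jac}(W)\,dx_1\cdots dx_N$ by $\lambda\cdot(x^r\,dx_1\cdots dx_N)=\prod_j\lambda_j^{r_j+1}\;x^r\,dx_1\cdots dx_N$. Grade this space over $\mathbb{Q}$ by $\deg x_j=-2q_j$ and $\deg dx_j=1-2q_j$, so that for $a\in\mathbb{Q}$ the degree-$a$ part $(\mathrm{Jac}(W)\,dx_1\cdots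 dx_N)_a$ is spanned by the classes of the forms $x^r\,dx_1\cdots dx_N$ with $\sum_j\bigl(1-2q_j(r_j+1)\bigr)=a$; each of these parts is stable under $G_W^{\max}$. Then for all $a,b\in\mathbb{Q}$ with $a\ne b$, $$\mathrm{Hom}_{\mathbb{C}[G_W^{\max}]}\bigl((\mathrm{Jac}(W)\,dx_1\cdots dx_N)_a,\ (\mathrm{Jac}(W)\,dx_1\cdots dx_N)_b\bigr)=0,$$ that is, every $G_W^{\max}$-equivariant $\mathbb{C}$-linear map from the degree-$a$ part to the degree-$b$ part is zero. -/

import Mathlib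

open scoped Topology

namespace LandauGinzburg

open MvPolynomial

variable {N : ℕ}

/-- `q` is a system of rational weights for `W`: `0 < q i ≤ 1/2`, and `W` is quasi-homogeneous
of weight `1` when the variable `x_i` has weight `q i`. -/
def IsWeightSystem (W : MvPolynomial (Fin N) ℂ) (q : Fin N → ℚ) : Prop :=
  (∀ i, 0 < q i ∧ q i ≤ 1 / 2) ∧ IsWeightedHomogeneous q W 1

/-- `W ∈ ℂ[x_1, …, x_N]` has an isolated critical point at the origin. -/
def HasIsolatedCriticalPoint (W : MvPolynomial (Fin N) ℂ) : Prop :=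
  (∀ i, eval 0 (pderiv i W) = 0) ∧
    ∀ᶠ x in 𝓝[≠] (0 : Fin N → ℂ), ∃ i, eval x (pderiv i W) ≠ 0

/-- `W ∈ ℂ[x_1, …, x_N]` is an invertible polynomial: it is quasi-homogeneous with weights in
`(0, 1/2]`, non-degenerate (isolated critical point at the origin, no monomial `x_i x_j` with
`i ≠ j`), it has as many monomials as variables, and its (square) exponent matrix, whose rows are
the exponent vectors of the monomials that occur in `W`, is invertible. -/
structure IsInvertible (W : MvPolynomial (Fin N) ℂ) : Prop where
  quasiHomogeneous : ∃ q : Fin N → ℚ, IsWeightSystem W q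
  isolated : HasIsolatedCriticalPoint W
  noCrossTerm : ∀ i j : Fin N, i ≠ j → coeff (Finsupp.single i 1 + Finsupp.single j 1) W = 0
  card_support : W.support.card = N
  exponents : LinearIndependent ℚ (fun (d : W.support) (i : Fin N) => ((d.1 i : ℕ) : ℚ))

/-- The substitution `f(x_1, …, x_N) ↦ f(c_1 x_1, …, c_N x_N)`. -/
noncomputable def rescale (c : Fin N → ℂˣ) :
    MvPolynomial (Fin N) ℂ →ₐ[ℂ] MvPolynomial (Fin N) ℂ :=
  aeval fun i => C (c i : ℂ) * X i

@[simp] lemma rescale_X (c : Fin N → ℂˣ) (i : Fin N) :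
    rescale c (X i) = C (c i : ℂ) * X i := by
  simp [rescale]

lemma rescale_one : rescale (1 : Fin N → ℂˣ) = AlgHom.id ℂ _ := by
  ext i : 1
  simp

lemma rescale_mul (c d : Fin N → ℂˣ) : rescale (c * d) = (rescale c).comp (rescale d) := by
  ext i : 1
  simp only [rescale_X, AlgHom.comp_apply, map_mul, Pi.mul_apply, Units.val_mul,
    ← algebraMap_eq, AlgHom.commutes]
  ring

lemma rescale_monomial (c : Fin N → ℂˣ) (r : Fin N →₀ ℕ) (z : ℂ) :
    rescale c (monomial r z) = (∏ i, (c i : ℂ) ^ r i) • monomial r z := by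
  rw [monomial_eq, map_mul, Finsupp.prod_fintype _ _ (by simp), map_prod,
    ← algebraMap_eq, AlgHom.commutes]
  simp only [map_pow, rescale_X, mul_pow, Finset.prod_mul_distrib, smul_eq_C_mul, map_prod]
  ring

lemma pderiv_rescale (c : Fin N → ℂˣ) (i : Fin N) (f : MvPolynomial (Fin N) ℂ) :
    pderiv i (rescale c f) = C (c i : ℂ) * rescale c (pderiv i f) := by
  induction f using MvPolynomial.induction_on with
  | C a => simp [rescale]
  | add p q hp hq => simp [hp, hq, mul_add]
  | mul_X p j hp =>
    by_cases h : i = j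
    · subst h
      simp [Derivation.leibniz, hp]
      ring
    · simp [Derivation.leibniz, hp, pderiv_X_of_ne (Ne.symm h)]
      ring

/-- The maximal diagonal symmetry group
`G_W^max = {(c_1, …, c_N) ∈ (ℂˣ)^N ∣ W(c_1 x_1, …, c_N x_N) = W}`. -/
def maxSymmetryGroup (W : MvPolynomial (Fin N) ℂ) : Subgroup (Fin N → ℂˣ) where
  carrier := {c | rescale c W = W}
  one_mem' := by simp [rescale_one]
  mul_mem' := by
    intro c d hc hd
    simp only [Set.mem_ofPred_eq] at hc hd ⊢
    rw [rescale_mul, AlgHom.comp_apply, hd, hc]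
  inv_mem' := by
    intro c hc
    simp only [Set.mem_ofPred_eq] at hc ⊢
    conv_lhs => rw [← hc]
    rw [← AlgHom.comp_apply, ← rescale_mul, inv_mul_cancel, rescale_one, AlgHom.id_apply]

/-- The ideal generated by the partial derivatives of `W`. -/
noncomputable def jacobianIdeal (W : MvPolynomial (Fin N) ℂ) : Ideal (MvPolynomial (Fin N) ℂ) :=
  Ideal.span (Set.range fun i => pderiv i W)

/-- The Jacobian ring `Jac(W) = ℂ[x_1, …, x_N] / (∂_1 W, …, ∂_N W)`. -/
abbrev Jac (W : MvPolynomial (Fin N) ℂ) : Type :=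
  MvPolynomial (Fin N) ℂ ⧸ jacobianIdeal W

/-- The space `Jac(W) dx_1 ⋯ dx_N`, free of rank one over `Jac(W)` on the symbol `dx_1 ⋯ dx_N`;
the form `f dx_1 ⋯ dx_N` is recorded by its coefficient `f ∈ Jac(W)`. The symbol `dx_1 ⋯ dx_N`
enters through the degree (`formDegree`) and through the group action (`formRep`). -/
abbrev JacForms (W : MvPolynomial (Fin N) ℂ) : Type := Jac W

/-- The class of the form `x^r dx_1 ⋯ dx_N`. -/
noncomputable def monomialForm (W : MvPolynomial (Fin N) ℂ) (r : Fin N →₀ ℕ) : JacForms W :=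
  Ideal.Quotient.mk (jacobianIdeal W) (monomial r 1)

lemma jacobianIdeal_le_comap {W : MvPolynomial (Fin N) ℂ} (c : maxSymmetryGroup W) :
    jacobianIdeal W ≤ (jacobianIdeal W).comap (rescale c.1) := by
  refine Ideal.span_le.2 ?_
  rintro _ ⟨i, rfl⟩
  have h : C (c.1 i : ℂ) * rescale c.1 (pderiv i W) = pderiv i W := by
    rw [← pderiv_rescale, show rescale c.1 W = W from c.2]
  have h' : rescale c.1 (pderiv i W) = C ((c.1 i : ℂ)⁻¹) * pderiv i W := by
    conv_rhs => rw [← h]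
    rw [← mul_assoc, ← C_mul, inv_mul_cancel₀ (c.1 i).ne_zero, C_1, one_mul]
  simp only [SetLike.mem_coe, Ideal.mem_comap]
  rw [h']
  exact Ideal.mul_mem_left _ _ (Ideal.subset_span ⟨i, rfl⟩)

/-- The action of `G_W^max` on the Jacobian ring, `f(x) ↦ f(c_1 x_1, …, c_N x_N)`. -/
noncomputable def jacAct (W : MvPolynomial (Fin N) ℂ) (c : maxSymmetryGroup W) :
    Jac W →ₐ[ℂ] Jac W :=
  Ideal.quotientMapₐ (jacobianIdeal W) (rescale c.1) (jacobianIdeal_le_comap c)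

lemma jacAct_mk (W : MvPolynomial (Fin N) ℂ) (c : maxSymmetryGroup W)
    (f : MvPolynomial (Fin N) ℂ) :
    jacAct W c (Ideal.Quotient.mk _ f) = Ideal.Quotient.mk _ (rescale c.1 f) := rfl

/-- The action of `G_W^max` on `Jac(W) dx_1 ⋯ dx_N`:
`c · [f dx_1 ⋯ dx_N] = [f(c_1 x_1, …, c_N x_N) d(c_1 x_1) ⋯ d(c_N x_N)]`. -/
noncomputable def formRep (W : MvPolynomial (Fin N) ℂ) :
    Representation ℂ (maxSymmetryGroup W) (JacForms W) where
  toFun c := (∏ i, (c.1 i : ℂ)) • (jacAct W c).toLinearMap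
  map_one' := by
    refine LinearMap.ext fun f => ?_
    obtain ⟨f, rfl⟩ := Ideal.Quotient.mk_surjective f
    rw [LinearMap.smul_apply, AlgHom.toLinearMap_apply, jacAct_mk]
    simp [rescale_one]
  map_mul' c d := by
    refine LinearMap.ext fun f => ?_
    obtain ⟨f, rfl⟩ := Ideal.Quotient.mk_surjective f
    rw [Module.End.mul_apply, LinearMap.smul_apply, LinearMap.smul_apply, LinearMap.smul_apply,
      map_smul, AlgHom.toLinearMap_apply, AlgHom.toLinearMap_apply, AlgHom.toLinearMap_apply,
      jacAct_mk, jacAct_mk, jacAct_mk, smul_smul, ← Finset.prod_mul_distrib, Subgroup.coe_mul,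
      rescale_mul, AlgHom.comp_apply]
    simp only [Pi.mul_apply, Units.val_mul]

lemma formRep_monomialForm (W : MvPolynomial (Fin N) ℂ) (c : maxSymmetryGroup W)
    (r : Fin N →₀ ℕ) :
    formRep W c (monomialForm W r) = (∏ i, (c.1 i : ℂ) ^ (r i + 1)) • monomialForm W r := by
  have h : formRep W c (monomialForm W r) =
      (∏ i, (c.1 i : ℂ)) • Ideal.Quotient.mk (jacobianIdeal W) (rescale c.1 (monomial r 1)) := rfl
  have h' : Ideal.Quotient.mk (jacobianIdeal W) ((∏ i, (c.1 i : ℂ) ^ r i) • monomial r 1) =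
      (∏ i, (c.1 i : ℂ) ^ r i) • monomialForm W r := rfl
  rw [h, rescale_monomial, h', smul_smul, ← Finset.prod_mul_distrib]
  simp only [pow_succ']

/-- The degree of `x^r dx_1 ⋯ dx_N`, where `deg x_i = -2 q_i` and `deg dx_i = -2 q_i + 1`. -/
def formDegree (q : Fin N → ℚ) (r : Fin N →₀ ℕ) : ℚ :=
  ∑ i, (r i * (-2 * q i) + (-2 * q i + 1))

/-- The degree `a` part of `Jac(W) dx_1 ⋯ dx_N`, spanned by the classes of the forms
`x^r dx_1 ⋯ dx_N` of degree `a`, as a subrepresentation for `G_W^max`. -/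
noncomputable def gradedPart (W : MvPolynomial (Fin N) ℂ) (q : Fin N → ℚ) (a : ℚ) :
    Subrepresentation (formRep W) where
  toSubmodule := Submodule.span ℂ (monomialForm W '' {r | formDegree q r = a})
  apply_mem_toSubmodule c v hv := by
    induction hv using Submodule.span_induction with
    | mem x hx =>
      obtain ⟨r, hr, rfl⟩ := hx
      rw [formRep_monomialForm]
      exact Submodule.smul_mem _ _ (Submodule.subset_span ⟨r, hr, rfl⟩)
    | zero => rw [map_zero]; exact Submodule.zero_mem _
    | add x y _ _ hx hy => rw [map_add]; exact Submodule.add_mem _ hx hy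
    | smul z x _ hx => rw [map_smul]; exact Submodule.smul_mem _ _ hx

end LandauGinzburg

/-!
Since the origin is an isolated critical point, no coordinate axis is critical, so for each `i` some
monomial of `W` has the form `x_i ^ (a i)` or `x_i ^ (a i) * x_{σ i}`. The weight bound and the
absence of cross terms give `a i ≥ 2`, so these `N` monomials are distinct, and `W` has no others.
Isolatedness also makes the partial function `σ` injective (`IsInvertible.exists_isArrowPolynomial`),
so `W` is a sum of chains and loops.

In the Jacobian ring, the relation `∂_k W = 0` with `σ i = some k` rewrites `x_i ^ (a i)` as a
multiple of a monomial of the same degree. On loops this rewriting need not terminate, but up to a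
rescaling of the variables its coefficients have absolute value `a k ≥ 2`, so each graded part is
still spanned by the reduced monomials `x^r`, `r i < a i` (`IsArrowPolynomial.span_reduced`).

If two reduced forms `x^r dx` and `x^s dx` carry the same character of the symmetry group, duality
of abelian groups writes `r - s` as an integral combination, with coefficients `m i`, of the
exponent vectors of `W` (`IsArrowPolynomial.exists_sub_eq_sum`). As each of these vectors has
weight `1`, the degrees differ by `-2 * ∑ i, m i`. The bounds `|r i - s i| < a i` force `m` to vanish
except on loops of even length, where it may alternate between `1` and `-1`; hence its sum is zero
(`sum_eq_zero_of_abs_lt`). Parts of different degree therefore have no character in common, and an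
equivariant map between them vanishes.
-/

namespace LandauGinzburg

/-! ### Invertible polynomials as sums of chains and loops -/

open MvPolynomial

/-- The exponent vector of `x_i ^ (a i)` times the variable `x_{σ i}`, where the second factor is
absent when `σ i = none`. -/
noncomputable def arrowExponent {N : ℕ} (a : Fin N → ℕ) (σ : Fin N → Option (Fin N))
    (i : Fin N) : Fin N →₀ ℕ :=
  Finsupp.single i (a i) + (σ i).elim 0 fun j => Finsupp.single j 1

/-- `W = ∑ i, c i * x_i ^ (a i) * x_{σ i}` with all `a i ≥ 2` and `c i ≠ 0`, where `σ` is an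
injective partial function without fixed points (`σ i = none` means that the factor `x_{σ i}` is
absent). The graph of `σ` is thus a disjoint union of chains and loops. -/
structure IsArrowPolynomial {N : ℕ} (W : MvPolynomial (Fin N) ℂ) (a : Fin N → ℕ)
    (σ : Fin N → Option (Fin N)) (c : Fin N → ℂ) : Prop where
  two_le : ∀ i, 2 ≤ a i
  ne_self : ∀ i, σ i ≠ some i
  injective : ∀ i j k, σ i = some k → σ j = some k → i = j
  coeff_ne_zero : ∀ i, c i ≠ 0
  eq_sum : W = ∑ i, monomial (arrowExponent a σ i) (c i)
  isUnit_exponents :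
    IsUnit (Matrix.of fun i j => ((arrowExponent a σ i j : ℕ) : ℚ) : Matrix (Fin N) (Fin N) ℚ)

variable {N : ℕ} {W : MvPolynomial (Fin N) ℂ} {a : Fin N → ℕ} {σ : Fin N → Option (Fin N)}
  {c : Fin N → ℂ} {q : Fin N → ℚ}

lemma arrowExponent_apply (i j : Fin N) :
    arrowExponent a σ i j = (if i = j then a i else 0) + if σ i = some j then 1 else 0 := by
  cases h : σ i <;> simp [arrowExponent, h, Finsupp.single_apply]

lemma arrowExponent_self (hσ : ∀ i, σ i ≠ some i) (i : Fin N) : arrowExponent a σ i i = a i := by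
  simp [arrowExponent_apply, hσ]

/-- When all `a i ≥ 2`, the variable `x_i` is the only one with exponent at least `2` in
`x_i ^ (a i) * x_{σ i}`. -/
lemma arrowExponent_injective (ha : ∀ i, 2 ≤ a i) : Function.Injective (arrowExponent a σ) := by
  intro i j hij
  by_contra hne
  have h := DFunLike.congr_fun hij i
  have h2 := ha i
  simp only [arrowExponent_apply, if_true, Ne.symm hne, if_false] at h
  split_ifs at h <;> omega

lemma IsWeightSystem.sum_eq_one (hq : IsWeightSystem W q) {d : Fin N →₀ ℕ} (hd : d ∈ W.support) :
    ∑ i, (d i : ℚ) * q i = 1 := by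
  have := hq.2 (mem_support_iff.1 hd)
  rw [Finsupp.weight_eq_sum] at this
  simpa using this

lemma single_one_notMem_support (hq : IsWeightSystem W q) (i : Fin N) :
    Finsupp.single i 1 ∉ W.support := by
  intro h
  have h1 := hq.sum_eq_one h
  have h2 := (hq.1 i).2
  simp only [Finsupp.single_apply, Nat.cast_ite, Nat.cast_one, Nat.cast_zero, ite_mul, one_mul,
    zero_mul, Finset.sum_ite_eq, Finset.mem_univ, if_true] at h1
  linarith

/-- A punctured curve through the origin does not consist of critical points. -/
lemma HasIsolatedCriticalPoint.exists_eval_ne_zero (hW : HasIsolatedCriticalPoint W)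
    {γ : ℂ → Fin N → ℂ} (hγ : Continuous γ) (h0 : γ 0 = 0) (hne : ∀ s ≠ 0, γ s ≠ 0) :
    ∃ s k, eval (γ s) (pderiv k W) ≠ 0 := by
  have ht : Filter.Tendsto γ (𝓝[≠] 0) (𝓝[≠] 0) := by
    refine tendsto_nhdsWithin_iff.2 ⟨?_, ?_⟩
    · rw [← h0]
      exact hγ.continuousAt.tendsto.mono_left nhdsWithin_le_nhds
    · filter_upwards [self_mem_nhdsWithin] with s hs using hne s hs
  obtain ⟨s, hs⟩ := (ht.eventually hW.2).exists
  exact ⟨s, hs⟩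

/-- Otherwise the whole `x_i`-axis would be critical. -/
lemma IsInvertible.exists_arrow (hW : IsInvertible W) (i : Fin N) :
    ∃ (n : ℕ) (o : Option (Fin N)), 2 ≤ n ∧ o ≠ some i ∧
      Finsupp.single i n + (o.elim 0 fun j => Finsupp.single j 1) ∈ W.support := by
  obtain ⟨q, hq⟩ := hW.quasiHomogeneous
  by_contra! hcon
  obtain ⟨s, k, hsk⟩ := hW.isolated.exists_eval_ne_zero (γ := fun s => Pi.single i s)
    (continuous_single (A := fun _ => ℂ) i) (by simp) (by simp)
  apply hsk
  rw [W.as_sum, map_sum, map_sum]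
  refine Finset.sum_eq_zero fun d hd => ?_
  rw [pderiv_monomial, eval_monomial]
  by_cases hdk : d k = 0
  · simp [hdk]
  by_cases hl : ∃ l, l ≠ i ∧ (d - Finsupp.single k 1 : Fin N →₀ ℕ) l ≠ 0
  · obtain ⟨l, hli, hl⟩ := hl
    rw [Finsupp.prod, Finset.prod_eq_zero (Finsupp.mem_support_iff.2 hl), mul_zero]
    rw [Pi.single_eq_of_ne hli, zero_pow hl]
  exfalso
  push Not at hl
  have hd' : d = Finsupp.single i ((d - Finsupp.single k 1 : Fin N →₀ ℕ) i) +
      Finsupp.single k 1 := by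
    ext l
    by_cases hli : l = i
    · subst hli
      by_cases hlk : l = k
      · subst hlk
        simp only [Finsupp.tsub_apply, Finsupp.add_apply, Finsupp.single_eq_same]
        omega
      · simp [Ne.symm hlk]
    · have := hl l hli
      by_cases hlk : l = k
      · subst hlk
        simp only [Finsupp.tsub_apply, Finsupp.single_eq_same] at this
        simp only [Finsupp.add_apply, Finsupp.single_eq_same, Finsupp.single_apply,
          Ne.symm hli, if_false]
        omega
      · simpa [Finsupp.single_apply, Ne.symm hlk, Ne.symm hli] using this
  set n := (d - Finsupp.single k 1 : Fin N →₀ ℕ) i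
  rw [hd'] at hd
  have hn0 : n ≠ 0 := by
    intro h0
    rw [h0, Finsupp.single_zero, zero_add] at hd
    exact single_one_notMem_support hq k hd
  by_cases hki : k = i
  · subst hki
    refine hcon (n + 1) none (by omega) (by simp) ?_
    simpa [Finsupp.single_add] using hd
  · have hn1 : n ≠ 1 := by
      intro h1
      rw [h1] at hd
      exact mem_support_iff.1 hd (hW.noCrossTerm i k (Ne.symm hki))
    exact hcon n (some k) (by omega) (by simpa using hki) hd

/-- If `σ i = σ j = some k` with `i ≠ j`, the curve `c_i x_i ^ (a i) + c_j x_j ^ (a j) = 0` in the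
`(x_i, x_j)`-plane is critical. -/
lemma arrow_injective_of_isolated (ha : ∀ i, 2 ≤ a i) (hσ : ∀ i, σ i ≠ some i)
    (hc : ∀ i, c i ≠ 0) (hW : HasIsolatedCriticalPoint (∑ i, monomial (arrowExponent a σ i) (c i)))
    (i j k : Fin N) (hi : σ i = some k) (hj : σ j = some k) : i = j := by
  by_contra hij
  have hki : k ≠ i := by rintro rfl; exact hσ _ hi
  have hkj : k ≠ j := by rintro rfl; exact hσ _ hj
  obtain ⟨μ, hμ⟩ := IsAlgClosed.exists_pow_nat_eq (-(c i / c j)) (n := a j) (by have := ha j; omega)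
  have ha0 : ∀ l, a l ≠ 0 := fun l => by have := ha l; omega
  -- The exponents make both terms proportional to `s ^ (a i * a j)`.
  obtain ⟨s, l, hsl⟩ := hW.exists_eval_ne_zero
    (γ := fun s => Pi.single i (s ^ a j) + Pi.single j (μ * s ^ a i))
    (by
      refine Continuous.add ((continuous_single i).comp ?_) ((continuous_single j).comp ?_) <;>
      fun_prop)
    (by simp [ha0])
    (by
      intro s hs h
      have := congrFun h i
      simp [hij, hs] at this)
  apply hsl
  set x : Fin N → ℂ := Pi.single i (s ^ a j) + Pi.single j (μ * s ^ a i) with hx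
  have hxi : x i = s ^ a j := by simp [hx, hij]
  have hxj : x j = μ * s ^ a i := by simp [hx, Ne.symm hij]
  have hx0 : ∀ m, m ≠ i → m ≠ j → x m = 0 := fun m h1 h2 => by simp [hx, h1, h2]
  have hzero : ∀ (m p : Fin N) (z : ℂ), m ≠ i → m ≠ j → arrowExponent a σ p m ≠ 0 →
      (l = m → arrowExponent a σ p m ≠ 1) →
      eval x (pderiv l (monomial (arrowExponent a σ p) z)) = 0 := by
    intro m p z h1 h2 h3 h4
    rw [pderiv_monomial, eval_monomial, Finsupp.prod,
      Finset.prod_eq_zero (i := m) (Finsupp.mem_support_iff.2 ?_), mul_zero]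
    · rw [hx0 m h1 h2, zero_pow]
      simp only [Finsupp.tsub_apply, Finsupp.single_apply]
      split_ifs with h
      · have := h4 h; omega
      · omega
    · simp only [Finsupp.tsub_apply, Finsupp.single_apply]
      split_ifs with h
      · have := h4 h; omega
      · omega
  have hk : ∀ p, σ p = some k → k ≠ p → arrowExponent a σ p k = 1 := fun p hp hkp => by
    simp [arrowExponent_apply, hp, Ne.symm hkp]
  rw [map_sum, map_sum, Finset.sum_eq_add_of_mem i j (Finset.mem_univ _) (Finset.mem_univ _) hij]
  · by_cases hlk : l = k
    · subst hlk
      have hev : ∀ p, σ p = some l → l ≠ p →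
          eval x (pderiv l (monomial (arrowExponent a σ p) (c p))) = c p * x p ^ a p := by
        intro p hp hlp
        have : arrowExponent a σ p - Finsupp.single l 1 = Finsupp.single p (a p) := by
          simp [arrowExponent, hp]
        rw [pderiv_monomial, this, hk p hp hlp, eval_monomial]
        simp
      rw [hev i hi hki, hev j hj hkj, hxi, hxj, mul_pow, hμ, ← pow_mul, ← pow_mul,
        mul_comm (a i)]
      have := hc j
      field_simp
      ring
    · rw [hzero k i _ hki hkj (by simp [hk i hi hki]) (fun h => absurd h hlk),
        hzero k j _ hki hkj (by simp [hk j hj hkj]) (fun h => absurd h hlk), add_zero]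
  · intro p _ hp
    have := ha p
    exact hzero p p _ hp.1 hp.2 (by rw [arrowExponent_self hσ]; omega)
      (fun _ => by rw [arrowExponent_self hσ]; omega)

/-- Every invertible polynomial is a sum of chains and loops. -/
theorem IsInvertible.exists_isArrowPolynomial (hW : IsInvertible W) :
    ∃ a σ c, IsArrowPolynomial W a σ c := by
  choose a σ ha hσ hmem using hW.exists_arrow
  have hinj := arrowExponent_injective (σ := σ) ha
  -- There are as many monomials as variables, so there is no further monomial.
  let e : Fin N → W.support := fun i => ⟨arrowExponent a σ i, hmem i⟩
  have he : Function.Bijective e := by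
    rw [Fintype.bijective_iff_injective_and_card]
    exact ⟨fun i j h => hinj (congrArg Subtype.val h), by simp [hW.card_support]⟩
  have hsum : W = ∑ i, monomial (arrowExponent a σ i) (coeff (arrowExponent a σ i) W) := by
    conv_lhs => rw [W.as_sum, ← Finset.sum_coe_sort]
    exact (Fintype.sum_bijective e he _ _ fun i => rfl).symm
  have hc : ∀ i, coeff (arrowExponent a σ i) W ≠ 0 := fun i => mem_support_iff.1 (hmem i)
  refine ⟨a, σ, fun i => coeff (arrowExponent a σ i) W, ha, hσ,
    arrow_injective_of_isolated ha hσ hc (hsum ▸ hW.isolated), hc, hsum, ?_⟩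
  rw [← Matrix.linearIndependent_rows_iff_isUnit]
  exact hW.exponents.comp e he.1

/-! ### Relations in the Jacobian ring -/

lemma monomialForm_add (r s : Fin N →₀ ℕ) :
    monomialForm W (r + s) = monomialForm W r * monomialForm W s := by
  rw [monomialForm, monomialForm, monomialForm, ← map_mul, monomial_mul, one_mul]

lemma mk_monomial (r : Fin N →₀ ℕ) (z : ℂ) :
    Ideal.Quotient.mk (jacobianIdeal W) (monomial r z) = z • monomialForm W r := by
  have : monomial r z = z • (monomial r 1 : MvPolynomial (Fin N) ℂ) := by
    rw [smul_monomial, smul_eq_mul, mul_one]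
  rw [this]
  rfl

lemma IsArrowPolynomial.sum_pderiv_eq_zero (h : IsArrowPolynomial W a σ c) (k : Fin N) :
    ∑ i, (c i * arrowExponent a σ i k) •
      monomialForm W (arrowExponent a σ i - Finsupp.single k 1) = 0 := by
  have : Ideal.Quotient.mk (jacobianIdeal W) (pderiv k W) = 0 :=
    Ideal.Quotient.eq_zero_iff_mem.2 (Ideal.subset_span ⟨k, rfl⟩)
  rw [congrArg (pderiv k) h.eq_sum, map_sum, map_sum] at this
  simpa only [pderiv_monomial, mk_monomial] using this

/-- Every monomial of `W` vanishes in the Jacobian ring: the relations `x_k ∂_k W = 0` form a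
linear system in these monomials whose matrix is invertible. -/
lemma IsArrowPolynomial.monomialForm_arrowExponent (h : IsArrowPolynomial W a σ c) (i : Fin N) :
    monomialForm W (arrowExponent a σ i) = 0 := by
  have euler : ∀ k, ∑ j, ((arrowExponent a σ j k : ℕ) : ℂ) •
      c j • monomialForm W (arrowExponent a σ j) = 0 := by
    intro k
    have := congrArg (fun z => monomialForm W (Finsupp.single k 1) * z) (h.sum_pderiv_eq_zero k)
    simp only [mul_zero, Finset.mul_sum] at this
    rw [← this]
    refine Finset.sum_congr rfl fun j _ => ?_
    by_cases hj : arrowExponent a σ j k = 0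
    · simp [hj]
    · rw [mul_smul_comm, ← monomialForm_add, add_tsub_cancel_of_le, smul_smul, mul_comm]
      exact Finsupp.single_le_iff.2 (by omega)
  obtain ⟨B, hB⟩ := h.isUnit_exponents.exists_right_inv
  have hB' : ∀ j, ∑ k, ((arrowExponent a σ j k : ℕ) : ℂ) * ((B k i : ℚ) : ℂ) =
      if j = i then 1 else 0 := by
    intro j
    have := congrFun (congrFun hB j) i
    rw [Matrix.mul_apply, Matrix.one_apply] at this
    have := congrArg (fun z : ℚ => (z : ℂ)) this
    simpa [apply_ite (fun z : ℚ => (z : ℂ))] using this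
  have key : ∑ k, ((B k i : ℚ) : ℂ) • ∑ j, ((arrowExponent a σ j k : ℕ) : ℂ) •
      c j • monomialForm W (arrowExponent a σ j) = c i • monomialForm W (arrowExponent a σ i) := by
    simp only [Finset.smul_sum (r := (_ : ℂ))]
    rw [Finset.sum_comm]
    simp only [smul_smul _ (_ : ℂ) (_ • _)]
    simp only [← Finset.sum_smul]
    simp only [mul_comm ((B _ i : ℚ) : ℂ), hB', ite_smul, one_smul, zero_smul,
      Finset.sum_ite_eq', Finset.mem_univ, if_true]
  simp only [euler, smul_zero, Finset.sum_const_zero] at key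
  exact (smul_eq_zero.1 key.symm).resolve_left (h.coeff_ne_zero i)

/-- The relation `∂_k W = 0` for `σ i = some k`. -/
lemma IsArrowPolynomial.smul_monomialForm_single (h : IsArrowPolynomial W a σ c) {i k : Fin N}
    (hik : σ i = some k) :
    c i • monomialForm W (Finsupp.single i (a i)) =
      (-(c k * a k)) • monomialForm W (arrowExponent a σ k - Finsupp.single k 1) := by
  have hne : i ≠ k := by rintro rfl; exact h.ne_self _ hik
  have hsum := h.sum_pderiv_eq_zero k
  rw [Finset.sum_eq_add_of_mem i k (Finset.mem_univ _) (Finset.mem_univ _) hne,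
    arrowExponent_self h.ne_self] at hsum
  · have h1 : arrowExponent a σ i k = 1 := by simp [arrowExponent_apply, hne, hik]
    have h2 : arrowExponent a σ i - Finsupp.single k 1 = Finsupp.single i (a i) := by
      simp [arrowExponent, hik]
    rw [h1, h2, Nat.cast_one, mul_one] at hsum
    rw [neg_smul]
    exact eq_neg_of_add_eq_zero_left hsum
  · rintro j - ⟨hji, hjk⟩
    have : arrowExponent a σ j k = 0 := by
      have : σ j ≠ some k := fun hj => hji (h.injective j i k hj hik)
      simp [arrowExponent_apply, hjk, this]
    simp [this]

/-- Rewriting a monomial `x^u` with `u i ≥ a i`, `σ i = some k`: it is a multiple of the monomial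
`x^v` with `v = u - E_i + E_k`, where `E` are the exponent vectors of `W`. -/
lemma IsArrowPolynomial.exists_rewrite (h : IsArrowPolynomial W a σ c) {i k : Fin N}
    (hik : σ i = some k) {u : Fin N →₀ ℕ} (hu : a i ≤ u i) :
    ∃ v, v + arrowExponent a σ i = u + arrowExponent a σ k ∧
      c i • monomialForm W u = (-(c k * a k)) • monomialForm W v := by
  have hle : Finsupp.single i (a i) ≤ u := Finsupp.single_le_iff.2 hu
  have hle' : Finsupp.single k 1 ≤ arrowExponent a σ k := by
    rw [Finsupp.single_le_iff, arrowExponent_self h.ne_self]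
    have := h.two_le k
    omega
  refine ⟨(u - Finsupp.single i (a i)) + (arrowExponent a σ k - Finsupp.single k 1), ?_, ?_⟩
  · have : arrowExponent a σ i = Finsupp.single i (a i) + Finsupp.single k 1 := by
      simp [arrowExponent, hik]
    rw [this]
    nth_rewrite 2 [← tsub_add_cancel_of_le hle]
    nth_rewrite 2 [← tsub_add_cancel_of_le hle']
    exact add_add_add_comm _ _ _ _
  · nth_rewrite 1 [← tsub_add_cancel_of_le hle]
    rw [monomialForm_add, monomialForm_add, ← mul_smul_comm, h.smul_monomialForm_single hik,
      mul_smul_comm]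

/-! ### Reduced monomials span the graded parts -/

lemma IsArrowPolynomial.sum_weight (h : IsArrowPolynomial W a σ c) (hq : IsWeightSystem W q)
    (i : Fin N) : ∑ j, (arrowExponent a σ i j : ℚ) * q j = 1 := by
  refine hq.sum_eq_one ?_
  rw [mem_support_iff, h.eq_sum, coeff_sum]
  simp only [coeff_monomial, (arrowExponent_injective h.two_le).eq_iff]
  simpa using h.coeff_ne_zero i

lemma formDegree_eq (r : Fin N →₀ ℕ) :
    formDegree q r = -2 * ∑ i, (r i : ℚ) * q i + ∑ i, (-2 * q i + 1) := by
  rw [formDegree, Finset.sum_add_distrib, Finset.mul_sum]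
  congr 1
  exact Finset.sum_congr rfl fun i _ => by ring

lemma formDegree_eq_iff (r s : Fin N →₀ ℕ) :
    formDegree q r = formDegree q s ↔ ∑ i, (r i : ℚ) * q i = ∑ i, (s i : ℚ) * q i := by
  rw [formDegree_eq, formDegree_eq]
  constructor <;> intro h <;> linarith

lemma finite_setOf_formDegree_eq (hq : ∀ i, 0 < q i) (b : ℚ) :
    {r : Fin N →₀ ℕ | formDegree q r = b}.Finite := by
  rcases Set.eq_empty_or_nonempty {r : Fin N →₀ ℕ | formDegree q r = b} with h0 | ⟨r₀, hr₀⟩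
  · rw [h0]; exact Set.finite_empty
  refine (Set.finite_Iic (Finsupp.equivFunOnFinite.symm fun i =>
    ⌈(∑ j, (r₀ j : ℚ) * q j) / q i⌉₊)).subset fun r hr => ?_
  have hr' := (formDegree_eq_iff r r₀).1 (Eq.trans hr (Eq.symm hr₀))
  intro i
  have h1 : (r i : ℚ) * q i ≤ ∑ j, (r₀ j : ℚ) * q j := by
    rw [← hr']
    exact Finset.single_le_sum (f := fun j => (r j : ℚ) * q j)
      (fun j _ => mul_nonneg (Nat.cast_nonneg _) (hq j).le) (Finset.mem_univ i)
  have h2 := ((le_div_iff₀ (hq i)).2 h1).trans (Nat.le_ceil _)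
  exact_mod_cast h2

/-- The part of degree `b` is spanned by the reduced monomials, those with `r i < a i`.
A linear functional vanishing on these but not on the whole part is evaluated on the finitely many
monomials of degree `b`. After scaling the variables so that all `|c i|` become `1`, the rewriting
`x^u ↦ x^v` divides its absolute value by `a k ≥ 2`, so the smallest nonzero value cannot exist. -/
theorem IsArrowPolynomial.span_reduced (h : IsArrowPolynomial W a σ c) (hq : IsWeightSystem W q)
    (b : ℚ) :
    Submodule.span ℂ (monomialForm W '' {r | formDegree q r = b}) =
      Submodule.span ℂ (monomialForm W '' {r | formDegree q r = b ∧ ∀ i, r i < a i}) := by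
  refine le_antisymm (Submodule.span_le.2 ?_)
    (Submodule.span_mono (Set.image_mono fun r hr => hr.1))
  rintro _ ⟨u₀, hu₀, rfl⟩
  by_contra hnot
  obtain ⟨ℓ, hℓ, hker⟩ := Submodule.exists_le_ker_of_notMem hnot
  -- `exp (w i)` is the scaling factor of `x_i`.
  obtain ⟨w, hw⟩ : ∃ w : Fin N → ℝ, ∀ i, ∑ j, (arrowExponent a σ i j : ℝ) * w j =
      Real.log ‖c i‖ := by
    obtain ⟨B, hB⟩ := h.isUnit_exponents.exists_right_inv
    refine ⟨fun j => ∑ k, ((B j k : ℚ) : ℝ) * Real.log ‖c k‖, fun i => ?_⟩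
    have hB' : ∀ k, ∑ j, (arrowExponent a σ i j : ℝ) * ((B j k : ℚ) : ℝ) =
        if i = k then 1 else 0 := by
      intro k
      have := congrFun (congrFun hB i) k
      rw [Matrix.mul_apply, Matrix.one_apply] at this
      have := congrArg (fun z : ℚ => (z : ℝ)) this
      simpa [apply_ite (fun z : ℚ => (z : ℝ))] using this
    simp only [Finset.mul_sum, ← mul_assoc]
    rw [Finset.sum_comm]
    simp only [← Finset.sum_mul, hB']
    simp
  let T : Set (Fin N →₀ ℕ) := {r | formDegree q r = b ∧ ℓ (monomialForm W r) ≠ 0}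
  obtain ⟨u, ⟨hub, huℓ⟩, hmin⟩ := Set.exists_min_image T
    (fun r => ‖ℓ (monomialForm W r)‖ * Real.exp (∑ j, (r j : ℝ) * w j))
    ((finite_setOf_formDegree_eq (fun i => (hq.1 i).1) b).subset fun r hr => hr.1)
    ⟨u₀, hu₀, hℓ⟩
  have hred : ¬ ∀ i, u i < a i := fun hr =>
    huℓ (hker (Submodule.subset_span ⟨u, ⟨hub, hr⟩, rfl⟩))
  push Not at hred
  obtain ⟨i, hi⟩ := hred
  rcases hσ : σ i with _ | k
  · -- Here `x_i ^ (a i)` is itself a monomial of `W`.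
    apply huℓ
    have hi0 := h.monomialForm_arrowExponent i
    rw [arrowExponent, hσ, Option.elim_none, add_zero] at hi0
    rw [← tsub_add_cancel_of_le (Finsupp.single_le_iff.2 hi), monomialForm_add, hi0, mul_zero,
      map_zero]
  · obtain ⟨v, hv, hrel⟩ := h.exists_rewrite hσ hi
    have hci := h.coeff_ne_zero i
    have hck := h.coeff_ne_zero k
    have hak := h.two_le k
    have hvj : ∀ j, v j + arrowExponent a σ i j = u j + arrowExponent a σ k j :=
      fun j => DFunLike.congr_fun hv j
    have hvb : formDegree q v = b := by
      rw [← hub, formDegree_eq_iff]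
      have h1 := h.sum_weight hq i
      have h2 := h.sum_weight hq k
      have h3 : ∑ j, ((v j : ℚ) * q j + arrowExponent a σ i j * q j) =
          ∑ j, ((u j : ℚ) * q j + arrowExponent a σ k j * q j) :=
        Finset.sum_congr rfl fun j _ => by
          rw [← add_mul, ← add_mul]
          exact_mod_cast congrArg (fun n : ℕ => (n : ℚ) * q j) (hvj j)
      rw [Finset.sum_add_distrib, Finset.sum_add_distrib] at h3
      linarith
    have hvw : Real.exp (∑ j, (v j : ℝ) * w j) * ‖c i‖ =
        Real.exp (∑ j, (u j : ℝ) * w j) * ‖c k‖ := by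
      rw [← Real.exp_log (norm_pos_iff.2 hci), ← Real.exp_log (norm_pos_iff.2 hck), ← hw i, ← hw k,
        ← Real.exp_add, ← Real.exp_add, ← Finset.sum_add_distrib, ← Finset.sum_add_distrib]
      congr 1
      refine Finset.sum_congr rfl fun j _ => ?_
      rw [← add_mul, ← add_mul]
      exact_mod_cast congrArg (fun n : ℕ => (n : ℝ) * w j) (hvj j)
    have hℓrel : c i * ℓ (monomialForm W u) = -(c k * a k) * ℓ (monomialForm W v) := by
      simpa using congrArg ℓ hrel
    have hvℓ : ℓ (monomialForm W v) ≠ 0 := by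
      intro h0
      rw [h0, mul_zero] at hℓrel
      exact (mul_ne_zero hci huℓ) hℓrel
    have hle := hmin v ⟨hvb, hvℓ⟩
    have hnorm := congrArg norm hℓrel
    rw [norm_mul, norm_mul, norm_neg, norm_mul, Complex.norm_natCast] at hnorm
    have hpv : 0 < ‖ℓ (monomialForm W v)‖ := norm_pos_iff.2 hvℓ
    have hpi : 0 < ‖c i‖ := norm_pos_iff.2 hci
    have hev := Real.exp_pos (∑ j, (v j : ℝ) * w j)
    set eu := Real.exp (∑ j, (u j : ℝ) * w j)
    set ev := Real.exp (∑ j, (v j : ℝ) * w j)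
    have hak' : (2 : ℝ) ≤ a k := by exact_mod_cast hak
    have h1 : ‖ℓ (monomialForm W u)‖ * eu * ‖c i‖ =
        a k * (‖ℓ (monomialForm W v)‖ * ev * ‖c i‖) := by
      linear_combination eu * hnorm - (a k : ℝ) * ‖ℓ (monomialForm W v)‖ * hvw
    have h2 : 0 < ‖ℓ (monomialForm W v)‖ * ev * ‖c i‖ := by positivity
    have h3 := mul_le_mul_of_nonneg_right hle hpi.le
    nlinarith

/-! ### Characters of the symmetry group and degrees -/

/-- The homomorphism `x ↦ exp (2πix)` from `ℚ/ℤ` to `ℂˣ`, from the additive to the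
multiplicative group. -/
noncomputable def rootOfUnityHom : AddCircle (1 : ℚ) →+ Additive ℂˣ :=
  QuotientAddGroup.lift (AddSubgroup.zmultiples (1 : ℚ))
    { toFun := fun x => Additive.ofMul
        (Units.mk0 (Complex.exp (2 * Real.pi * Complex.I * (x : ℂ))) (Complex.exp_ne_zero _))
      map_zero' := by
        apply Additive.toMul.injective
        ext
        simp
      map_add' := fun x y => by
        apply Additive.toMul.injective
        ext
        simp [mul_add, Complex.exp_add] }
    (by
      rw [AddSubgroup.zmultiples_le]
      apply Additive.toMul.injective
      ext
      simp [Complex.exp_two_pi_mul_I])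

lemma rootOfUnityHom_injective : Function.Injective rootOfUnityHom := by
  rw [injective_iff_map_eq_zero]
  intro x hx
  induction x using QuotientAddGroup.induction_on with
  | H x =>
    have h1 : Complex.exp (2 * Real.pi * Complex.I * (x : ℂ)) = 1 :=
      congrArg (fun z : Additive ℂˣ => ((Additive.toMul z : ℂˣ) : ℂ)) hx
    obtain ⟨n, hn⟩ := Complex.exp_eq_one_iff.1 h1
    have h2 : (x : ℂ) = n := by
      have := Complex.two_pi_I_ne_zero
      apply mul_left_cancel₀ this
      rw [hn]; ring
    have h3 : x = n := by exact_mod_cast h2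
    rw [QuotientAddGroup.eq_zero_iff, AddSubgroup.mem_zmultiples_iff]
    exact ⟨n, by simp [h3]⟩

/-- Duality for the diagonal symmetry group: if every symmetry acts on the forms `x^r dx` and
`x^s dx` by the same scalar, then `r - s` is an integral combination of the exponent vectors of
`W`. Otherwise a character of the quotient by these vectors, with values in the roots of unity,
would give a symmetry that distinguishes them. -/
lemma IsArrowPolynomial.exists_sub_eq_sum (h : IsArrowPolynomial W a σ c) (r s : Fin N →₀ ℕ)
    (hrs : ∀ g ∈ maxSymmetryGroup W,
      ∏ i, (g i : ℂ) ^ (r i + 1) = ∏ i, (g i : ℂ) ^ (s i + 1)) :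
    ∃ m : Fin N → ℤ, ∀ j, (r j : ℤ) - s j = ∑ i, m i * arrowExponent a σ i j := by
  let E : Fin N → Fin N → ℤ := fun i j => arrowExponent a σ i j
  let L : Submodule ℤ (Fin N → ℤ) := Submodule.span ℤ (Set.range E)
  let t : Fin N → ℤ := fun j => (r j : ℤ) - s j
  suffices ht : t ∈ L by
    obtain ⟨m, hm⟩ := (Submodule.mem_span_range_iff_exists_fun ℤ).1 ht
    refine ⟨m, fun j => ?_⟩
    have := congrFun hm j
    simp only [Finset.sum_apply, Pi.smul_apply, smul_eq_mul] at this
    exact this.symm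
  by_contra ht
  have ht' : L.mkQ t ≠ 0 := by simpa using ht
  obtain ⟨χ, hχ⟩ := CharacterModule.exists_character_apply_ne_zero_of_ne_zero ht'
  let ψ : (Fin N → ℤ) →+ Additive ℂˣ :=
    (rootOfUnityHom.comp (χ : _ →+ AddCircle (1 : ℚ))).comp L.mkQ.toAddMonoidHom
  have hψt : ψ t ≠ 0 := fun h0 => hχ (rootOfUnityHom_injective (h0.trans (map_zero _).symm))
  let g : Fin N → ℂˣ := fun i => Additive.toMul (ψ (Pi.single i 1))
  have hψ : ∀ v : Fin N → ℤ, Additive.toMul (ψ v) = ∏ i, g i ^ v i := by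
    intro v
    conv_lhs => rw [← Finset.univ_sum_single v]
    rw [map_sum, toMul_sum]
    refine Finset.prod_congr rfl fun i _ => ?_
    have : (Pi.single i (v i) : Fin N → ℤ) = v i • Pi.single i 1 := by
      rw [← Pi.single_smul]; simp
    rw [this, map_zsmul, toMul_zsmul]
  have hg : g ∈ maxSymmetryGroup W := by
    change rescale g W = W
    conv_lhs => rw [h.eq_sum]
    conv_rhs => rw [h.eq_sum]
    rw [map_sum]
    refine Finset.sum_congr rfl fun i _ => ?_
    rw [rescale_monomial]
    have h0 : ψ (E i) = 0 := by
      have : L.mkQ (E i) = 0 := by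
        simpa using Submodule.subset_span (R := ℤ) (Set.mem_range_self (f := E) i)
      change rootOfUnityHom (χ (L.mkQ (E i))) = 0
      rw [this, map_zero, map_zero]
    have h1 := hψ (E i)
    rw [h0, toMul_zero] at h1
    have h2 := congrArg (fun z : ℂˣ => (z : ℂ)) h1
    simp only [Units.val_one, Units.coe_prod, E, zpow_natCast, Units.val_pow_eq_pow_val] at h2
    rw [← h2, one_smul]
  have h1 := hrs g hg
  have h2 : ∏ i, g i ^ (r i + 1) = ∏ i, g i ^ (s i + 1) := by
    apply Units.ext
    simpa only [Units.coe_prod, Units.val_pow_eq_pow_val] using h1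
  apply hψt
  apply Additive.toMul.injective
  rw [hψ, toMul_zero]
  simp only [t, zpow_sub, zpow_natCast, Finset.prod_mul_distrib, Finset.prod_inv_distrib]
  simp only [pow_succ, Finset.prod_mul_distrib] at h2
  rw [mul_right_cancel h2, mul_inv_cancel]

/-- An integral combination of the rows of the exponent matrix with all entries smaller than the
`a i` has coefficient sum zero: the coefficients lie in `{-1, 0, 1}`, and `σ` permutes the indices
with nonzero coefficient while switching the sign. -/
lemma sum_eq_zero_of_abs_lt (ha : ∀ i, 2 ≤ a i)
    (hσ : ∀ i j k, σ i = some k → σ j = some k → i = j)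
    (m : Fin N → ℤ) (hm : ∀ j, |∑ i, m i * arrowExponent a σ i j| < a j) :
    ∑ i, m i = 0 := by
  have hsum : ∀ j, ∑ i, m i * (arrowExponent a σ i j : ℤ) =
      a j * m j + ∑ i, if σ i = some j then m i else 0 := by
    intro j
    simp only [arrowExponent_apply, Nat.cast_add, mul_add, Finset.sum_add_distrib]
    congr 1
    · simp [mul_comm]
    · simp
  have hpred : ∀ i j, σ i = some j → (∑ i, if σ i = some j then m i else 0) = m i := by
    intro i j hij
    rw [Finset.sum_eq_single i]
    · simp [hij]
    · intro l _ hl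
      exact if_neg fun hlj => hl (hσ l i j hlj hij)
    · simp
  have hex : ∀ j, m j ≠ 0 → ∃ i, σ i = some j := by
    intro j hj
    by_contra! hno
    have h1 := hm j
    simp only [hsum, hno, if_false, Finset.sum_const_zero, add_zero, abs_mul, Nat.abs_cast] at h1
    have h2 := Int.one_le_abs hj
    have : (a j : ℤ) * 1 ≤ a j * |m j| := mul_le_mul_of_nonneg_left h2 (by positivity)
    omega
  have hlt : ∀ i j, σ i = some j → |a j * m j + m i| < a j := by
    intro i j hij
    have := hm j
    rwa [hsum, hpred i j hij] at this
  -- At an index where `|m j|` is maximal, its predecessor would have a larger `|m i|`.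
  have hle1 : ∀ j, |m j| ≤ 1 := by
    intro j₀
    obtain ⟨j, -, hj⟩ := Finset.exists_max_image Finset.univ (fun j => |m j|) ⟨j₀, Finset.mem_univ _⟩
    refine (hj j₀ (Finset.mem_univ _)).trans ?_
    by_contra! hbig
    obtain ⟨i, hij⟩ := hex j (by intro h0; simp [h0] at hbig)
    have h1 := hlt i j hij
    have h2 := hj i (Finset.mem_univ _)
    have h3 : |(a j : ℤ) * m j| ≤ |a j * m j + m i| + |m i| := by
      simpa using abs_sub (a j * m j + m i) (m i)
    rw [abs_mul, Nat.abs_cast] at h3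
    have h4 : (2 : ℤ) ≤ a j := by exact_mod_cast ha j
    nlinarith
  have hneg : ∀ i j, σ i = some j → m j ≠ 0 → m i = -m j := by
    intro i j hij hj
    have h1 := hlt i j hij
    have h2 := abs_le.1 (hle1 i)
    have h3 := abs_le.1 (hle1 j)
    have h4 : (2 : ℤ) ≤ a j := by exact_mod_cast ha j
    rw [abs_lt] at h1
    obtain h5 | h5 : m j = 1 ∨ m j = -1 := by omega
    · rw [h5] at h1 ⊢; omega
    · rw [h5] at h1 ⊢; omega
  choose τ hτ using fun j : {j // m j ≠ 0} => hex j.1 j.2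
  let π : {j // m j ≠ 0} → {j // m j ≠ 0} := fun j => ⟨τ j, by
    rw [hneg _ _ (hτ j) j.2]; exact neg_ne_zero.2 j.2⟩
  have hπ : Function.Injective π := by
    intro j k hjk
    have h1 : τ j = τ k := congrArg Subtype.val hjk
    have h2 := hτ j
    rw [h1, hτ k] at h2
    exact Subtype.ext (Option.some.inj h2).symm
  have hperm : ∑ j, m (π j).1 = ∑ j : {j // m j ≠ 0}, m j.1 :=
    (Finite.injective_iff_bijective.1 hπ).sum_comp fun j : {j // m j ≠ 0} => m j.1
  have hflip : ∑ j, m (π j).1 = -∑ j : {j // m j ≠ 0}, m j.1 := by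
    rw [← Finset.sum_neg_distrib]
    exact Finset.sum_congr rfl fun j _ => hneg _ _ (hτ j) j.2
  have htotal : ∑ j : {j // m j ≠ 0}, m j.1 = ∑ j, m j :=
    (Finset.sum_subtype (Finset.univ.filter fun j => m j ≠ 0) (by simp) m).symm.trans
      (Finset.sum_filter_ne_zero _)
  omega

/-- Reduced monomials whose forms carry the same character of the symmetry group have the same
degree. -/
theorem IsArrowPolynomial.formDegree_eq_of_character_eq (h : IsArrowPolynomial W a σ c)
    (hq : IsWeightSystem W q) {r s : Fin N →₀ ℕ} (hr : ∀ i, r i < a i) (hs : ∀ i, s i < a i)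
    (hrs : ∀ g ∈ maxSymmetryGroup W,
      ∏ i, (g i : ℂ) ^ (r i + 1) = ∏ i, (g i : ℂ) ^ (s i + 1)) :
    formDegree q r = formDegree q s := by
  obtain ⟨m, hm⟩ := h.exists_sub_eq_sum r s hrs
  have hsum : ∑ i, m i = 0 := by
    refine sum_eq_zero_of_abs_lt h.two_le h.injective m fun j => ?_
    rw [← hm j, abs_lt]
    have := hr j
    have := hs j
    omega
  rw [formDegree_eq_iff, ← sub_eq_zero, ← Finset.sum_sub_distrib]
  have h1 : ∀ j, (r j : ℚ) * q j - s j * q j = ∑ i, (m i : ℚ) * (arrowExponent a σ i j * q j) := by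
    intro j
    rw [← sub_mul]
    have : ((r j : ℤ) - s j : ℚ) = ∑ i, (m i : ℚ) * arrowExponent a σ i j := by
      exact_mod_cast hm j
    rw [Int.cast_natCast] at this
    rw [this, Finset.sum_mul]
    simp only [mul_assoc]
  simp only [h1]
  rw [Finset.sum_comm]
  simp only [← Finset.mul_sum, h.sum_weight hq, mul_one]
  exact_mod_cast hsum

/-! ### Equivariant maps -/

/-- A simultaneous eigenvector that is a sum of simultaneous eigenvectors for other characters
vanishes. -/
lemma eq_zero_of_eq_sum_of_character_ne {G V ι : Type*} [Monoid G] [AddCommGroup V] [Module ℂ V]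
    (ρ : Representation ℂ G V) (χ : G → ℂ) (θ : ι → G → ℂ) (S : Finset ι) (v : ι → V) (x : V)
    (hne : ∀ i ∈ S, θ i ≠ χ) (hv : ∀ i ∈ S, ∀ g, ρ g (v i) = θ i g • v i)
    (hx : ∀ g, ρ g x = χ g • x) (hsum : x = ∑ i ∈ S, v i) : x = 0 := by
  classical
  induction S using Finset.induction_on generalizing v with
  | empty => simpa using hsum
  | insert i₀ S hi₀ ih =>
    obtain ⟨g, hg⟩ := Function.ne_iff.1 (hne i₀ (Finset.mem_insert_self _ _))
    have hg' : χ g - θ i₀ g ≠ 0 := sub_ne_zero.2 hg.symm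
    -- `ρ g - θ i₀ g` removes the summand `v i₀` and rescales `x` by a nonzero factor.
    refine ih (fun i => (χ g - θ i₀ g)⁻¹ • (θ i g - θ i₀ g) • v i)
      (fun i hi => hne i (Finset.mem_insert_of_mem hi)) (fun i hi k => ?_) ?_
    · rw [map_smul, map_smul, hv i (Finset.mem_insert_of_mem hi), smul_comm _ (θ i k),
        smul_comm _ (θ i k)]
    · have h1 : (χ g - θ i₀ g) • x = ∑ i ∈ S, (θ i g - θ i₀ g) • v i := by
        rw [sub_smul, ← hx g]
        nth_rewrite 1 [hsum]
        rw [hsum, map_sum, Finset.smul_sum, ← Finset.sum_sub_distrib, Finset.sum_insert hi₀,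
          hv i₀ (Finset.mem_insert_self _ _), sub_self, zero_add]
        exact Finset.sum_congr rfl fun i hi => by
          rw [hv i (Finset.mem_insert_of_mem hi), sub_smul]
      rw [← Finset.smul_sum, ← h1, smul_smul, inv_mul_cancel₀ hg', one_smul]

end LandauGinzburg

theorem mainTheorem3 {N : ℕ} (W : MvPolynomial (Fin N) ℂ) (hW : LandauGinzburg.IsInvertible W)
    (q : Fin N → ℚ) (hq : LandauGinzburg.IsWeightSystem W q) (a b : ℚ) (hab : a ≠ b)
    (f : Representation.IntertwiningMap
      (LandauGinzburg.gradedPart W q a).toRepresentation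
      (LandauGinzburg.gradedPart W q b).toRepresentation) :
    f = 0 := by
  open LandauGinzburg in
  obtain ⟨e, σ, c, h⟩ := hW.exists_isArrowPolynomial
  -- It suffices that `f` kills the reduced monomials of degree `a`.
  suffices hred : ∀ r, formDegree q r = a → (∀ i, r i < e i) →
      ∀ hr : monomialForm W r ∈ (gradedPart W q a).toSubmodule, (f ⟨_, hr⟩ : JacForms W) = 0 by
    have hle : (gradedPart W q a).toSubmodule ≤
        (LinearMap.ker f.toLinearMap).map (gradedPart W q a).toSubmodule.subtype := by
      refine (h.span_reduced hq a).trans_le (Submodule.span_le.2 ?_)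
      rintro _ ⟨r, ⟨hra, hr⟩, rfl⟩
      have hmem : monomialForm W r ∈ (gradedPart W q a).toSubmodule :=
        Submodule.subset_span ⟨r, hra, rfl⟩
      exact ⟨⟨_, hmem⟩, Subtype.ext (hred r hra hr hmem), rfl⟩
    ext x
    obtain ⟨y, hy, hyx⟩ := hle x.2
    obtain rfl : y = x := Subtype.ext hyx
    exact congrArg Subtype.val hy
  intro r hra hr hmem
  have hmem_b : (f ⟨_, hmem⟩ : JacForms W) ∈ Submodule.span ℂ
      (monomialForm W '' {s | formDegree q s = b ∧ ∀ i, s i < e i}) := by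
    rw [← h.span_reduced hq b]
    exact (f ⟨_, hmem⟩).2
  obtain ⟨l, hl, hfl⟩ := (Finsupp.mem_span_image_iff_linearCombination ℂ).1 hmem_b
  rw [Finsupp.linearCombination_apply, Finsupp.sum] at hfl
  refine eq_zero_of_eq_sum_of_character_ne (formRep W)
    (fun g => ∏ i, (g.1 i : ℂ) ^ (r i + 1)) (fun s g => ∏ i, (g.1 i : ℂ) ^ (s i + 1))
    l.support (fun s => l s • monomialForm W s) _ ?_ ?_ ?_ hfl.symm
  · intro s hs hchar
    obtain ⟨hsb, hs'⟩ := hl hs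
    apply hab
    rw [← hra, ← hsb]
    exact h.formDegree_eq_of_character_eq hq hr hs' fun g hg => (congrFun hchar ⟨g, hg⟩).symm
  · intro s _ g
    rw [map_smul, formRep_monomialForm, smul_comm]
  · intro g
    let x : (gradedPart W q a).toSubmodule := ⟨_, hmem⟩
    have h1 : (gradedPart W q a).toRepresentation g x = (∏ i, (g.1 i : ℂ) ^ (r i + 1)) • x :=
      Subtype.ext (formRep_monomialForm W g r)
    have h2 := f.isIntertwining _ _ g x
    rw [h1, map_smul] at h2
    exact (congrArg Subtype.val h2).symm
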